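/- Let $A=\{a,b,c\}$, let $A^*$ be the free monoid and $\Gamma_A$ the free group generated by $A$. A substitution is a monoid endomorphism $\sigma$ of $A^*$, written $\sigma=(\sigma(a),\sigma(b),\sigma(c))$; it is invertible if its natural extension to an endomorphism of $\Gamma_A$ is an automorphism of $\Gamma_A$. The substitution matrix $M_\sigma$ of $\sigma$ is the $3\times 3$ matrix whose entry in the row of the letter $x$ and the column of the letter $y$ is the number $|\sigma(y)|_x$ of occurrences of $x$ in $\sigma(y)$. A permutation is a substitution induced by a permutation of $A$. A Fibonacci substitution is a substitution of the form $\pi\circ\phi\circ\pi'$, where $\pi,\pi'$ are permutations and $\phi\in\{(ba,b,c),(ab,b,c)\}$. A non-negative elementary matrix is the substitution matrix of a permutation or of a Fibonacci substitution. **Theorem.** Let $M$ be a $3\times 3$ matrix with non-negative integer entries. Then $M$ is the substitution matrix of some invertible substitution over $A$ if and only if $M$ is a finite product of non-negative elementary matrices. -/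

import Mathlib

/-- The three-letter alphabet is `Fin 3`, with `a = 0`, `b = 1`, `c = 2`. A substitution is a
morphism of the free monoid on the alphabet. -/
abbrev Substitution : Type := FreeMonoid (Fin 3) →* FreeMonoid (Fin 3)

namespace Substitution

/-- The substitution sending `a, b, c` to `u, v, w` respectively. -/
def ofTriple (u v w : FreeMonoid (Fin 3)) : Substitution :=
  FreeMonoid.lift ![u, v, w]

/-- The natural extension of a substitution to an endomorphism of the free group: the letter `x`
is sent to the positive word `σ x`, viewed in the free group. -/
def extend (σ : Substitution) : FreeGroup (Fin 3) →* FreeGroup (Fin 3) :=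
  FreeGroup.lift fun x => FreeMonoid.lift FreeGroup.of (σ (FreeMonoid.of x))

/-- A substitution is invertible if its extension is an automorphism of the free group. -/
def IsInvertible (σ : Substitution) : Prop :=
  Function.Bijective σ.extend

/-- The substitution matrix: the entry `(i, j)` is the number of occurrences of the letter `i` in
the word `σ j`. -/
def toMatrix (σ : Substitution) : Matrix (Fin 3) (Fin 3) ℕ :=
  Matrix.of fun i j => (FreeMonoid.toList (σ (FreeMonoid.of j))).count i

/-- The substitution permuting the letters according to `π`. -/
def ofPerm (π : Equiv.Perm (Fin 3)) : Substitution :=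
  FreeMonoid.map π

/-- The substitutions that permute the letters. -/
def IsPermutation (σ : Substitution) : Prop :=
  ∃ π : Equiv.Perm (Fin 3), σ = ofPerm π

/-- `φ_l = (ba, b, c)`. -/
def phiL : Substitution :=
  ofTriple (FreeMonoid.of 1 * FreeMonoid.of 0) (FreeMonoid.of 1) (FreeMonoid.of 2)

/-- `φ_r = (ab, b, c)`. -/
def phiR : Substitution :=
  ofTriple (FreeMonoid.of 0 * FreeMonoid.of 1) (FreeMonoid.of 1) (FreeMonoid.of 2)

/-- Fibonacci substitutions: `π ∘ φ_l ∘ π'` or `π ∘ φ_r ∘ π'` with `π`, `π'` permutations. -/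
def IsFibonacci (σ : Substitution) : Prop :=
  ∃ π π' : Equiv.Perm (Fin 3),
    σ = (ofPerm π).comp (phiL.comp (ofPerm π')) ∨ σ = (ofPerm π).comp (phiR.comp (ofPerm π'))

end Substitution

/-- Non-negative elementary matrices: the substitution matrices of the permutations and of the
Fibonacci substitutions. -/
def IsNonnegElementary (E : Matrix (Fin 3) (Fin 3) ℕ) : Prop :=
  ∃ σ : Substitution, (σ.IsPermutation ∨ σ.IsFibonacci) ∧ σ.toMatrix = E

/-! Substitution matrices are multiplicative, and permutations and Fibonacci substitutions are
invertible; this gives one direction. The other uses only surjectivity of the extension: while the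
three images have total length above three, a Fibonacci factor is split off and the length drops; at
length three the substitution is a permutation.

The factor comes from Stallings folding. The images label the petals of a wedge of three directed
cycles. As they generate the free group, folding cannot stop before a single vertex is left
(`CarriesLoops.not_isFolded`), and merging two vertices at each fold keeps the number of edges at
most the number of vertices plus two. One fold before the end there are two vertices and at most
four edges, and inspection yields a letter `a` always preceded, or always followed, by some `b ≠ a`
(`hasForcedLetter_of_outgoing`). This holds in all concatenations of two images, so the images
factor through `a ↦ ba` or `a ↦ ab`, possibly after a common rotation (`exists_fibonacci_factor`). A
rotation is a conjugation in the free group and leaves the matrix unchanged. -/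

namespace LabelledGraph

/-! ### Walks, loop subgroups and folded graphs -/

variable {V W ι α : Type*}

/-- A step along an edge of a labelled graph, in the direction given by the sign. -/
def Step (E : Finset (V × α × V)) (x : V) (s : α × Bool) (y : V) : Prop :=
  if s.2 then (x, s.1, y) ∈ E else (y, s.1, x) ∈ E

/-- `Walk E x L y`: the signed word `L` labels a walk from `x` to `y`. -/
def Walk (E : Finset (V × α × V)) : V → List (α × Bool) → V → Prop
  | x, [], y => x = y
  | x, s :: L, y => ∃ z, Step E x s z ∧ Walk E z L y

/-- The signed word all of whose letters are positive. -/
def positive (L : List α) : List (α × Bool) := L.map fun a => (a, true)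

theorem walk_append {E : Finset (V × α × V)} {x y : V} {L₁ L₂ : List (α × Bool)} :
    Walk E x (L₁ ++ L₂) y ↔ ∃ z, Walk E x L₁ z ∧ Walk E z L₂ y := by
  induction L₁ generalizing x with
  | nil => simp [Walk]
  | cons s L ih =>
    simp only [List.cons_append, Walk, ih]
    constructor
    · rintro ⟨z, h, w, h₁, h₂⟩
      exact ⟨w, ⟨z, h, h₁⟩, h₂⟩
    · rintro ⟨w, ⟨z, h, h₁⟩, h₂⟩
      exact ⟨z, h, w, h₁, h₂⟩

theorem Walk.map {E : Finset (V × α × V)} {E' : Finset (W × α × W)} {f : V → W}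
    (hf : ∀ x a y, (x, a, y) ∈ E → (f x, a, f y) ∈ E') {x y : V} {L : List (α × Bool)}
    (h : Walk E x L y) : Walk E' (f x) L (f y) := by
  induction L generalizing x with
  | nil => exact congrArg f h
  | cons s L ih =>
    obtain ⟨z, hs, hw⟩ := h
    refine ⟨f z, ?_, ih hw⟩
    unfold Step at hs ⊢
    split_ifs at hs ⊢ <;> exact hf _ _ _ hs

theorem Step.symm {E : Finset (V × α × V)} {x y : V} {s : α × Bool} (h : Step E x s y) :
    Step E y (s.1, !s.2) x := by
  obtain ⟨a, b⟩ := s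
  cases b <;> simpa [Step] using h

theorem Walk.invRev {E : Finset (V × α × V)} {x y : V} {L : List (α × Bool)}
    (h : Walk E x L y) : Walk E y (FreeGroup.invRev L) x := by
  induction L generalizing x with
  | nil => exact h.symm
  | cons s L ih =>
    obtain ⟨z, hs, hw⟩ := h
    have : FreeGroup.invRev (s :: L) = FreeGroup.invRev L ++ [(s.1, !s.2)] := by
      simp [FreeGroup.invRev]
    rw [this, walk_append]
    exact ⟨z, ih hw, x, hs.symm, rfl⟩

/-- The elements of the free group that label closed walks at `v`. -/
def loopSubgroup (E : Finset (V × α × V)) (v : V) : Subgroup (FreeGroup α) where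
  carrier := {g | ∃ L, FreeGroup.mk L = g ∧ Walk E v L v}
  one_mem' := ⟨[], rfl, rfl⟩
  mul_mem' := by
    rintro _ _ ⟨L₁, rfl, h₁⟩ ⟨L₂, rfl, h₂⟩
    exact ⟨L₁ ++ L₂, FreeGroup.mul_mk.symm, walk_append.2 ⟨v, h₁, h₂⟩⟩
  inv_mem' := by
    rintro _ ⟨L, rfl, h⟩
    exact ⟨FreeGroup.invRev L, FreeGroup.inv_mk.symm, h.invRev⟩

/-- A labelled graph is folded if distinct edges with the same label share neither their source nor
their target. -/
def IsFolded (E : Finset (V × α × V)) : Prop :=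
  (∀ x a y y', (x, a, y) ∈ E → (x, a, y') ∈ E → y = y') ∧
    ∀ x x' a y, (x, a, y) ∈ E → (x', a, y) ∈ E → x = x'

theorem IsFolded.step_unique {E : Finset (V × α × V)} (hE : IsFolded E) {x y y' : V}
    {s : α × Bool} (h : Step E x s y) (h' : Step E x s y') : y = y' := by
  unfold Step at h h'
  split_ifs at h h'
  · exact hE.1 _ _ _ _ h h'
  · exact hE.2 _ _ _ _ h h'

/-- In a folded graph a step followed by its inverse returns to its start, so a cancelling pair can
be cut out of a walk. -/
theorem IsFolded.walk_of_red {E : Finset (V × α × V)} (hE : IsFolded E) {x y : V}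
    {L L' : List (α × Bool)} (hL : FreeGroup.Red L L') (h : Walk E x L y) : Walk E x L' y := by
  induction hL with
  | refl => exact h
  | tail _ hs ih =>
    obtain @⟨L₁, L₂, a, b⟩ := hs
    obtain ⟨z, h₁, t, h₂, w, h₃, h₄⟩ := walk_append.1 ih
    refine walk_append.2 ⟨z, h₁, ?_⟩
    rwa [hE.step_unique h₂.symm h₃]

theorem IsFolded.loop_of_mem {E : Finset (V × α × V)} (hE : IsFolded E) {v : V} {a : α}
    (h : FreeGroup.of a ∈ loopSubgroup E v) : (v, a, v) ∈ E := by
  obtain ⟨L, hL, hw⟩ := h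
  obtain ⟨L', h₁, h₂⟩ := FreeGroup.Red.exact.1 (hL : _ = FreeGroup.mk [(a, true)])
  rw [FreeGroup.Red.singleton_iff] at h₂
  subst h₂
  obtain ⟨z, hz, rfl⟩ := hE.walk_of_red h₁ hw
  simpa [Step] using hz

/-- Every letter labels a loop at `v`, and foldedness leaves room for no other edge at `v`. -/
theorem IsFolded.eq_of_walk {E : Finset (V × α × V)} (hE : IsFolded E) {v : V}
    (h : loopSubgroup E v = ⊤) {L : List (α × Bool)} {x : V} (hw : Walk E v L x) : x = v := by
  induction L with
  | nil => exact hw.symm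
  | cons s L ih =>
    obtain ⟨z, hz, hw⟩ := hw
    have hs : Step E v s v := by
      unfold Step
      split_ifs <;> exact hE.loop_of_mem (h ▸ Subgroup.mem_top _)
    exact ih (hE.step_unique hz hs ▸ hw)

theorem Walk.exists_exit {E : Finset (V × α × V)} (T : Set V) {x y : V} {L : List α}
    (h : Walk E x (positive L) y) (hx : x ∈ T) (hy : y ∉ T) :
    ∃ p a q, (p, a, q) ∈ E ∧ p ∈ T ∧ q ∉ T := by
  induction L generalizing x with
  | nil => exact absurd ((show x = y from h) ▸ hx) hy
  | cons a L ih =>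
    obtain ⟨z, hz, hw⟩ := h
    by_cases hzT : z ∈ T
    · exact ih hw hzT
    · exact ⟨x, a, z, by simpa [Step] using hz, hx, hzT⟩

theorem Walk.exists_edge_of_mem {E : Finset (V × α × V)} {x y : V} {L : List α}
    (h : Walk E x (positive L) y) {a : α} (ha : a ∈ L) : ∃ p q, (p, a, q) ∈ E := by
  induction L generalizing x with
  | nil => simp at ha
  | cons b L ih =>
    obtain ⟨z, hz, hw⟩ := h
    rcases List.mem_cons.1 ha with rfl | ha
    · exact ⟨x, z, by simpa [Step] using hz⟩
    · exact ih hw ha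

theorem Walk.isChain {E : Finset (V × α × V)} {R : α → α → Prop}
    (hR : ∀ p q r a b, (p, a, q) ∈ E → (q, b, r) ∈ E → R a b) {x y : V} {L : List α}
    (h : Walk E x (positive L) y) : L.IsChain R := by
  induction L generalizing x with
  | nil => exact List.isChain_nil
  | cons a L ih =>
    obtain ⟨z, hz, hw⟩ := h
    cases L with
    | nil => exact List.isChain_singleton _
    | cons b L =>
      refine List.isChain_cons_cons.2 ⟨?_, ih hw⟩
      obtain ⟨t, ht, -⟩ := hw
      exact hR x z t a b (by simpa [Step] using hz) (by simpa [Step] using ht)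

theorem walk_of_forall_step {E : Finset (V × α × V)} {L : List α} (p : ℕ → V)
    (h : ∀ (i : ℕ) (hi : i < L.length), (p i, L[i], p (i + 1)) ∈ E) :
    Walk E (p 0) (positive L) (p L.length) := by
  induction L generalizing p with
  | nil => rfl
  | cons a L ih =>
    refine ⟨p 1, h 0 (Nat.succ_pos _), ih (fun i => p (i + 1)) fun i hi => ?_⟩
    exact h (i + 1) (Nat.succ_lt_succ hi)

/-! ### Folding down to two vertices -/

/-- A strongly connected labelled graph of rank at most three, with vertex set `S`, edge set `E` and
base point `v`, in which the words `u j` label closed walks at `v`. -/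
structure CarriesLoops (u : ι → List α) (S : Finset V) (E : Finset (V × α × V)) (v : V) :
    Prop where
  edge_mem : ∀ x a y, (x, a, y) ∈ E → x ∈ S ∧ y ∈ S
  card_le : E.card ≤ S.card + 2
  base_mem : v ∈ S
  loop : ∀ j, Walk E v (positive (u j)) v
  reach : ∀ x ∈ S, ∃ L, Walk E v (positive L) x
  coreach : ∀ x ∈ S, ∃ L, Walk E x (positive L) v

/-- The words `u j` generate the free group. -/
def Generates (u : ι → List α) : Prop :=
  Subgroup.closure (Set.range fun j => FreeGroup.mk (positive (u j))) = ⊤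

namespace CarriesLoops

variable {u : ι → List α} {S : Finset V} {E : Finset (V × α × V)} {v : V}

theorem loopSubgroup_eq_top (h : CarriesLoops u S E v) (hu : Generates u) :
    loopSubgroup E v = ⊤ := by
  rw [eq_top_iff, ← hu, Subgroup.closure_le]
  rintro _ ⟨j, rfl⟩
  exact ⟨_, rfl, h.loop j⟩

theorem not_isFolded (h : CarriesLoops u S E v) (hu : Generates u) (hS : 1 < S.card) :
    ¬ IsFolded E := by
  intro hE
  obtain ⟨x, hx, hxv⟩ := Finset.exists_mem_ne hS v
  obtain ⟨L, hL⟩ := h.reach x hx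
  exact hxv (hE.eq_of_walk (h.loopSubgroup_eq_top hu) hL)

variable [DecidableEq V] [DecidableEq α]

/-- Gluing `q` to `p` removes exactly one vertex and at least one edge, since `e₁` and `e₂` become
equal; the rank bound therefore survives. -/
theorem fold (h : CarriesLoops u S E v) {p q : V} (hp : p ∈ S) (hq : q ∈ S) (hpq : p ≠ q)
    {e₁ e₂ : V × α × V} (h₁ : e₁ ∈ E) (h₂ : e₂ ∈ E) (he : e₁ ≠ e₂)
    (hf : Prod.map (Function.update id q p) (Prod.map id (Function.update id q p)) e₁ =
      Prod.map (Function.update id q p) (Prod.map id (Function.update id q p)) e₂) :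
    CarriesLoops u (S.erase q)
      (E.image (Prod.map (Function.update id q p) (Prod.map id (Function.update id q p))))
      (Function.update id q p v) := by
  set f : V → V := Function.update id q p with hfdef
  have fS : ∀ x ∈ S, f x ∈ S.erase q := by
    intro x hx
    by_cases hxq : x = q
    · simp [hfdef, hxq, hp, hpq]
    · simp [hfdef, hxq, hx]
  have fid : ∀ x ∈ S.erase q, f x = x := by
    intro x hx
    simp [hfdef, (Finset.mem_erase.1 hx).1]
  have fE : ∀ x a y, (x, a, y) ∈ E → (f x, a, f y) ∈ E.image (Prod.map f (Prod.map id f)) :=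
    fun x a y hx => Finset.mem_image.2 ⟨_, hx, rfl⟩
  refine ⟨?_, ?_, fS v h.base_mem, fun j => (h.loop j).map fE, fun x hx => ?_, fun x hx => ?_⟩
  · rintro x a y hx
    obtain ⟨⟨x', a', y'⟩, he', heq⟩ := Finset.mem_image.1 hx
    obtain ⟨rfl, rfl, rfl⟩ : f x' = x ∧ a' = a ∧ f y' = y := by simpa using heq
    exact ⟨fS _ (h.edge_mem _ _ _ he').1, fS _ (h.edge_mem _ _ _ he').2⟩
  · have hlt : (E.image (Prod.map f (Prod.map id f))).card < E.card := by
      refine lt_of_le_of_ne Finset.card_image_le fun hcard => he ?_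
      exact Finset.card_image_iff.1 hcard h₁ h₂ hf
    have := h.card_le
    have := Finset.card_erase_add_one hq
    omega
  · obtain ⟨L, hL⟩ := h.reach x (Finset.mem_of_mem_erase hx)
    exact ⟨L, fid x hx ▸ hL.map fE⟩
  · obtain ⟨L, hL⟩ := h.coreach x (Finset.mem_of_mem_erase hx)
    have := hL.map fE
    rw [fid x hx] at this
    exact ⟨L, this⟩

theorem exists_fold (h : CarriesLoops u S E v) (hu : Generates u) (hS : 1 < S.card) :
    ∃ S' E', ∃ v' : V, CarriesLoops u S' E' v' ∧ S'.card + 1 = S.card := by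
  have hE := h.not_isFolded hu hS
  simp only [IsFolded, not_and_or, not_forall] at hE
  rcases hE with ⟨x, a, y, y', h₁, h₂, hne⟩ | ⟨x, x', a, y, h₁, h₂, hne⟩
  · have hy' := (h.edge_mem _ _ _ h₂).2
    exact ⟨_, _, _, h.fold (h.edge_mem _ _ _ h₁).2 hy' hne h₁ h₂ (by simpa using hne)
      (by simp [Function.update, hne]), Finset.card_erase_add_one hy'⟩
  · have hx' := (h.edge_mem _ _ _ h₂).1
    exact ⟨_, _, _, h.fold (h.edge_mem _ _ _ h₁).1 hx' hne h₁ h₂ (by simpa using hne)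
      (by simp [Function.update, hne]), Finset.card_erase_add_one hx'⟩

theorem exists_card_eq_two (h : CarriesLoops u S E v) (hu : Generates u) (hS : 2 ≤ S.card) :
    ∃ S' E', ∃ v' : V, CarriesLoops u S' E' v' ∧ S'.card = 2 := by
  induction hn : S.card - 2 generalizing S E v with
  | zero => exact ⟨S, E, v, h, by omega⟩
  | succ n ih =>
    obtain ⟨S', E', v', h', hc⟩ := h.exists_fold hu (by omega)
    exact ih h' (by omega) (by omega)

end CarriesLoops

/-! ### Forced letters in graphs with two vertices -/

/-- On every directed walk some letter is always preceded, or always followed, by another one. -/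
def HasForcedLetter (E : Finset (V × α × V)) : Prop :=
  ∃ a b, a ≠ b ∧ ((∀ p q r c, (p, c, q) ∈ E → (q, a, r) ∈ E → c = b) ∨
    ∀ p q r c, (p, a, q) ∈ E → (q, c, r) ∈ E → c = b)

theorem hasForcedLetter_of_outgoing [DecidableEq V] {E : Finset (V × Fin 3 × V)} {x y : V}
    (hxy : x ≠ y) (hE : ∀ p a q, (p, a, q) ∈ E → (p = x ∨ p = y) ∧ (q = x ∨ q = y))
    (hcard : E.card ≤ 4) (hletter : ∀ a, ∃ p q, (p, a, q) ∈ E) (hback : ∃ c, (y, c, x) ∈ E)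
    {b : Fin 3} (h₁ : (x, b, x) ∈ E) (h₂ : (x, b, y) ∈ E) : HasForcedLetter E := by
  obtain ⟨c, hc⟩ := hback
  have hcb : c ≠ b := by
    -- Otherwise three edges carry `b`, and one more for each of the other two letters makes five.
    rintro rfl
    obtain ⟨a, a', ha, ha', haa'⟩ : ∃ a a' : Fin 3, a ≠ c ∧ a' ≠ c ∧ a ≠ a' := by
      clear hc h₁ h₂
      revert c; decide
    obtain ⟨p, q, hpq⟩ := hletter a
    obtain ⟨r, s, hrs⟩ := hletter a'
    have hsub : {(x, c, x), (x, c, y), (y, c, x), (p, a, q), (r, a', s)} ⊆ E := by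
      simp [Finset.insert_subset_iff, *]
    have := Finset.card_le_card hsub
    rw [Finset.card_insert_of_notMem, Finset.card_insert_of_notMem,
      Finset.card_insert_of_notMem, Finset.card_insert_of_notMem, Finset.card_singleton] at this
    · omega
    all_goals simp [hxy, hxy.symm, ha.symm, ha'.symm, haa']
  obtain ⟨a, hab, hac, hall⟩ : ∃ a : Fin 3, a ≠ b ∧ a ≠ c ∧ ∀ d, d = a ∨ d = b ∨ d = c := by
    clear h₁ h₂ hc
    revert b c; decide
  obtain ⟨p, q, hpq⟩ := hletter a
  have hsub : {(x, b, x), (x, b, y), (y, c, x), (p, a, q)} ⊆ E := by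
    simp [Finset.insert_subset_iff, *]
  -- These four edges exhaust the graph; only the endpoints of the edge labelled `a` remain to be
  -- distinguished.
  have heq := Finset.eq_of_subset_of_card_le hsub (by
    rw [Finset.card_insert_of_notMem, Finset.card_insert_of_notMem,
      Finset.card_insert_of_notMem, Finset.card_singleton]
    · exact hcard
    all_goals simp [hxy, hxy.symm, hab.symm, hac.symm, hcb.symm])
  obtain ⟨hp, hq⟩ := hE p a q hpq
  clear hE hcard hletter h₁ h₂ hc hpq hsub hall
  subst heq
  simp only [HasForcedLetter, Finset.mem_insert, Finset.mem_singleton, Prod.mk.injEq]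
  rcases hp with rfl | rfl <;> rcases hq with rfl | rfl
  -- If the `a`-edge does not end at `y`, then `y` is entered only by `b` and left by `c`. If it
  -- goes from `x` to `y`, it can only be followed by `c`. If it is a loop at `y`, then `c` leads to
  -- `x`, which is left only by `b`.
  · exact ⟨c, b, hcb, Or.inl (by grind)⟩
  · exact ⟨a, c, hac, Or.inr (by grind)⟩
  · exact ⟨c, b, hcb, Or.inl (by grind)⟩
  · exact ⟨c, b, hcb, Or.inr (by grind)⟩

/-- The graph with all edges reversed. -/
def reverse [DecidableEq V] [DecidableEq α] (E : Finset (V × α × V)) : Finset (V × α × V) :=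
  E.image fun e => (e.2.2, e.2.1, e.1)

theorem mem_reverse [DecidableEq V] [DecidableEq α] {E : Finset (V × α × V)} {x y : V} {a : α} :
    (x, a, y) ∈ reverse E ↔ (y, a, x) ∈ E := by
  simp only [reverse, Finset.mem_image, Prod.exists, Prod.mk.injEq]
  constructor
  · rintro ⟨_, _, _, h, rfl, rfl, rfl⟩
    exact h
  · exact fun h => ⟨_, _, _, h, rfl, rfl, rfl⟩

theorem HasForcedLetter.of_reverse [DecidableEq V] [DecidableEq α] {E : Finset (V × α × V)}
    (h : HasForcedLetter (reverse E)) : HasForcedLetter E := by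
  obtain ⟨a, b, hab, h | h⟩ := h <;> simp only [mem_reverse] at h
  · exact ⟨a, b, hab, Or.inr fun p q r c h₁ h₂ => h r q p c h₂ h₁⟩
  · exact ⟨a, b, hab, Or.inl fun p q r c h₁ h₂ => h r q p c h₂ h₁⟩

theorem hasForcedLetter_of_incoming [DecidableEq V] {E : Finset (V × Fin 3 × V)} {x y : V}
    (hxy : x ≠ y) (hE : ∀ p a q, (p, a, q) ∈ E → (p = x ∨ p = y) ∧ (q = x ∨ q = y))
    (hcard : E.card ≤ 4) (hletter : ∀ a, ∃ p q, (p, a, q) ∈ E) (hback : ∃ c, (x, c, y) ∈ E)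
    {b : Fin 3} (h₁ : (x, b, x) ∈ E) (h₂ : (y, b, x) ∈ E) : HasForcedLetter E := by
  refine HasForcedLetter.of_reverse (hasForcedLetter_of_outgoing hxy ?_
    (Finset.card_image_le.trans hcard) ?_ ?_ (mem_reverse.2 h₁) (mem_reverse.2 h₂))
  · exact fun p a q h => (hE q a p (mem_reverse.1 h)).symm
  · intro a
    obtain ⟨p, q, h⟩ := hletter a
    exact ⟨q, p, mem_reverse.2 h⟩
  · obtain ⟨c, hc⟩ := hback
    exact ⟨c, mem_reverse.2 hc⟩

/-- Two edges violating foldedness have one common end and distinct other ends, so one of them is a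
loop. Strong connectivity supplies the returning edge. -/
theorem CarriesLoops.hasForcedLetter [DecidableEq V] {u : ι → List (Fin 3)} {S : Finset V}
    {E : Finset (V × Fin 3 × V)} {v : V} (h : CarriesLoops u S E v) (hu : Generates u)
    (hocc : ∀ a, ∃ j, a ∈ u j) (hS : S.card = 2) : HasForcedLetter E := by
  have hletter : ∀ a, ∃ p q, (p, a, q) ∈ E := fun a =>
    let ⟨j, hj⟩ := hocc a
    (h.loop j).exists_edge_of_mem hj
  have hconn : ∀ x ∈ S, ∀ y ∈ S, x ≠ y → ∃ c, (x, c, y) ∈ E := by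
    intro x hx y hy hxy
    have hxyS : ∀ z ∈ S, z = x ∨ z = y := by
      have : {x, y} = S := Finset.eq_of_subset_of_card_le
        (by simp [Finset.insert_subset_iff, hx, hy]) (by rw [hS, Finset.card_pair hxy])
      intro z hz
      simpa [← this] using hz
    obtain ⟨L₁, h₁⟩ := h.coreach x hx
    obtain ⟨L₂, h₂⟩ := h.reach y hy
    have h₃ : Walk E x (positive (L₁ ++ L₂)) y := by
      rw [positive, List.map_append]
      exact walk_append.2 ⟨v, h₁, h₂⟩
    obtain ⟨p, a, q, he, hp, hq⟩ := h₃.exists_exit {x} rfl (by simpa using hxy.symm)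
    obtain rfl : p = x := hp
    obtain rfl : q = y := (hxyS q (h.edge_mem _ _ _ he).2).resolve_left hq
    exact ⟨a, he⟩
  have hends : ∀ x ∈ S, ∀ y ∈ S, x ≠ y →
      ∀ p a q, (p, a, q) ∈ E → (p = x ∨ p = y) ∧ (q = x ∨ q = y) := by
    intro x hx y hy hxy p a q he
    have : {x, y} = S := Finset.eq_of_subset_of_card_le
      (by simp [Finset.insert_subset_iff, hx, hy]) (by rw [hS, Finset.card_pair hxy])
    have := h.edge_mem _ _ _ he
    simpa [← ‹{x, y} = S›] using this
  have hcard : E.card ≤ 4 := by have := h.card_le; omega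
  have key := h.not_isFolded hu (by omega)
  simp only [IsFolded, not_and_or, not_forall] at key
  rcases key with ⟨x, a, y, y', h₁, h₂, hne⟩ | ⟨x, x', a, y, h₁, h₂, hne⟩
  · have hx := (h.edge_mem _ _ _ h₁).1
    have hy := (h.edge_mem _ _ _ h₁).2
    have hy' := (h.edge_mem _ _ _ h₂).2
    rcases (hends y hy y' hy' hne _ _ _ h₁).1 with rfl | rfl
    · exact hasForcedLetter_of_outgoing hne (hends _ hx _ hy' hne) hcard hletter
        (hconn _ hy' _ hx (Ne.symm hne)) h₁ h₂
    · exact hasForcedLetter_of_outgoing (Ne.symm hne) (hends _ hx _ hy (Ne.symm hne)) hcard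
        hletter (hconn _ hy _ hx hne) h₂ h₁
  · have hx := (h.edge_mem _ _ _ h₁).1
    have hx' := (h.edge_mem _ _ _ h₂).1
    have hy := (h.edge_mem _ _ _ h₁).2
    rcases (hends x hx x' hx' hne _ _ _ h₁).2 with rfl | rfl
    · exact hasForcedLetter_of_incoming hne (hends _ hx _ hx' hne) hcard hletter
        (hconn _ hx _ hx' hne) h₁ h₂
    · exact hasForcedLetter_of_incoming (Ne.symm hne) (hends _ hx' _ hx (Ne.symm hne)) hcard
        hletter (hconn _ hx' _ hx (Ne.symm hne)) h₂ h₁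

/-! ### The wedge of three cycles -/

/-- The vertices of the wedge of three directed cycles labelled `u j`. -/
def wedgeVertex (u : Fin 3 → List α) (j : Fin 3) (i : ℕ) : Σ _ : Fin 3, ℕ :=
  if i = 0 ∨ i = (u j).length then ⟨0, 0⟩ else ⟨j, i⟩

theorem exists_wedge [DecidableEq α] (u : Fin 3 → List α) (hu : ∀ j, u j ≠ []) :
    ∃ S E v, CarriesLoops (V := Σ _ : Fin 3, ℕ) u S E v ∧
      S.card + 2 = ∑ j, (u j).length := by
  set p := wedgeVertex u with hp
  have hlen : ∀ j, 0 < (u j).length := fun j => List.length_pos_iff.2 (hu j)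
  -- Interior vertices only: both ends of each cycle are the base point, so a cycle has one vertex
  -- fewer here than it has edges.
  let T : Finset (Σ _ : Fin 3, ℕ) := Finset.univ.sigma fun j => Finset.Ico 1 (u j).length
  let S : Finset (Σ _ : Fin 3, ℕ) := insert ⟨0, 0⟩ T
  let E : Finset ((Σ _ : Fin 3, ℕ) × α × (Σ _ : Fin 3, ℕ)) :=
    Finset.univ.image fun k : (Σ j : Fin 3, Fin (u j).length) =>
      (p k.1 k.2, (u k.1)[k.2], p k.1 (k.2 + 1))
  have p0 : ∀ j, p j 0 = ⟨0, 0⟩ := fun j => by simp [hp, wedgeVertex]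
  have plen : ∀ j, p j (u j).length = ⟨0, 0⟩ := fun j => by simp [hp, wedgeVertex]
  have pS : ∀ j i, i ≤ (u j).length → p j i ∈ S := by
    intro j i hi
    by_cases h : i = 0 ∨ i = (u j).length
    · simp [hp, wedgeVertex, h, S]
    · have : p j i = ⟨j, i⟩ := by simp [hp, wedgeVertex, h]
      rw [this]
      refine Finset.mem_insert_of_mem (Finset.mem_sigma.2 ⟨Finset.mem_univ _, ?_⟩)
      simp only [Finset.mem_Ico]
      omega
  have Sp : ∀ x ∈ S, ∃ j i, i ≤ (u j).length ∧ x = p j i := by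
    intro x hx
    rcases Finset.mem_insert.1 hx with rfl | hx
    · exact ⟨0, 0, Nat.zero_le _, (p0 0).symm⟩
    · obtain ⟨j, i⟩ := x
      have hi := Finset.mem_Ico.1 (Finset.mem_sigma.1 hx).2
      simp only at hi
      refine ⟨j, i, hi.2.le, ?_⟩
      rw [hp, wedgeVertex, if_neg (by omega)]
  have step : ∀ j i (hi : i < (u j).length), (p j i, (u j)[i], p j (i + 1)) ∈ E :=
    fun j i hi => Finset.mem_image.2 ⟨⟨j, ⟨i, hi⟩⟩, Finset.mem_univ _, rfl⟩
  have hScard : S.card + 2 = ∑ j, (u j).length := by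
    have h₀ : (⟨0, 0⟩ : Σ _ : Fin 3, ℕ) ∉ T := by simp [T]
    rw [Finset.card_insert_of_notMem h₀, Finset.card_sigma]
    have := hlen 0
    have := hlen 1
    have := hlen 2
    simp only [Nat.card_Ico, Fin.sum_univ_three]
    omega
  refine ⟨S, E, ⟨0, 0⟩, ⟨?_, ?_, Finset.mem_insert_self _ _, ?_, ?_, ?_⟩, hScard⟩
  · intro x a y h
    obtain ⟨⟨j, i⟩, -, h⟩ := Finset.mem_image.1 h
    obtain ⟨rfl, -, rfl⟩ := by simpa only [Prod.mk.injEq] using h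
    exact ⟨pS _ _ i.2.le, pS _ _ i.2⟩
  · rw [hScard]
    refine Finset.card_image_le.trans ?_
    simp
  · intro j
    have := walk_of_forall_step (p j) (step j)
    rwa [p0, plen] at this
  · intro x hx
    obtain ⟨j, i, hi, rfl⟩ := Sp x hx
    refine ⟨(u j).take i, ?_⟩
    have := walk_of_forall_step (E := E) (L := (u j).take i) (p j) fun k hk => by
      simp only [List.getElem_take]
      exact step j k (by simp at hk; omega)
    rwa [p0, List.length_take, min_eq_left hi] at this
  · intro x hx
    obtain ⟨j, i, hi, rfl⟩ := Sp x hx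
    refine ⟨(u j).drop i, ?_⟩
    have := walk_of_forall_step (E := E) (L := (u j).drop i) (fun k => p j (i + k)) fun k hk => by
      simp only [List.getElem_drop]
      exact step j (i + k) (by simp at hk; omega)
    simp only [List.length_drop, Nat.add_zero, Nat.add_sub_cancel' hi, plen] at this
    exact this

/-- In a generating triple of positive words other than the letters, some letter is always preceded,
or always followed, by another one, even across the boundary between two words. -/
theorem Generates.exists_forced {u : Fin 3 → List (Fin 3)} (hu : Generates u)
    (hne : ∀ j, u j ≠ []) (hocc : ∀ a, ∃ j, a ∈ u j) (hlen : 4 ≤ ∑ j, (u j).length) :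
    ∃ a b : Fin 3, a ≠ b ∧ ((∀ i j, (u i ++ u j).IsChain fun s t => t = a → s = b) ∨
      ∀ i j, (u i ++ u j).IsChain fun s t => s = a → t = b) := by
  obtain ⟨S, E, v, h, hS⟩ := exists_wedge u hne
  obtain ⟨S, E, v, h, hS⟩ := h.exists_card_eq_two hu (by omega)
  have hw : ∀ i j, Walk E v (positive (u i ++ u j)) v := fun i j => by
    rw [positive, List.map_append]
    exact walk_append.2 ⟨v, h.loop i, h.loop j⟩
  obtain ⟨a, b, hab, hf | hf⟩ := h.hasForcedLetter hu hocc hS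
  · refine ⟨a, b, hab, Or.inl fun i j => (hw i j).isChain ?_⟩
    rintro p q r c d h₁ h₂ rfl
    exact hf p q r c h₁ h₂
  · refine ⟨a, b, hab, Or.inr fun i j => (hw i j).isChain ?_⟩
    rintro p q r c d h₁ h₂ rfl
    exact hf p q r d h₁ h₂

end LabelledGraph

/-! ### Functoriality, and invertibility of the elementary substitutions -/

namespace Substitution

open LabelledGraph FreeMonoid

/-- The image of a letter, as a list. -/
def word (σ : Substitution) (j : Fin 3) : List (Fin 3) := toList (σ (of j))

/-- The substitution sending each letter `j` to the word `u j`. -/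
def ofWords (u : Fin 3 → List (Fin 3)) : Substitution := FreeMonoid.lift fun j => ofList (u j)

theorem word_ofWords (u : Fin 3 → List (Fin 3)) (j : Fin 3) : (ofWords u).word j = u j := by
  simp [word, ofWords]

theorem toMatrix_apply (σ : Substitution) (i j : Fin 3) :
    σ.toMatrix i j = (σ.word j).count i := rfl

theorem lift_of_eq_mk (w : FreeMonoid (Fin 3)) :
    FreeMonoid.lift FreeGroup.of w = FreeGroup.mk (positive (toList w)) := by
  induction w using FreeMonoid.inductionOn' with
  | one => rfl
  | of_mul x w ih =>
    rw [map_mul, ih, lift_eval_of, FreeGroup.of, FreeGroup.mul_mk]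
    rfl

theorem extend_of (σ : Substitution) (j : Fin 3) :
    σ.extend (FreeGroup.of j) = FreeGroup.mk (positive (σ.word j)) := by
  rw [extend, FreeGroup.lift_apply_of, lift_of_eq_mk, word]

theorem extend_lift_of (σ : Substitution) (w : FreeMonoid (Fin 3)) :
    σ.extend (FreeMonoid.lift FreeGroup.of w) = FreeMonoid.lift FreeGroup.of (σ w) := by
  have : σ.extend.comp (FreeMonoid.lift FreeGroup.of) =
      (FreeMonoid.lift FreeGroup.of).comp σ := FreeMonoid.hom_eq fun x => by simp [extend]
  exact DFunLike.congr_fun this w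

theorem extend_comp (σ τ : Substitution) :
    extend (σ.comp τ) = (extend σ).comp (extend τ) := by
  refine FreeGroup.ext_hom _ _ fun x => ?_
  have h : ∀ ρ : Substitution,
      ρ.extend (FreeGroup.of x) = FreeMonoid.lift FreeGroup.of (ρ (of x)) := fun ρ =>
    FreeGroup.lift_apply_of
  rw [MonoidHom.comp_apply, h, h, extend_lift_of, MonoidHom.comp_apply]

theorem extend_id : extend (MonoidHom.id _) = MonoidHom.id _ :=
  FreeGroup.ext_hom _ _ fun x => by simp [extend]

theorem count_apply (σ : Substitution) (i : Fin 3) (w : FreeMonoid (Fin 3)) :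
    (toList (σ w)).count i = ∑ k, σ.toMatrix i k * (toList w).count k := by
  induction w using FreeMonoid.inductionOn' with
  | one => simp
  | of_mul x w ih =>
    simp only [map_mul, toList_mul, List.count_append, ih, toList_of, List.singleton_append,
      List.count_cons, mul_add, Finset.sum_add_distrib, beq_iff_eq]
    simp [toMatrix, add_comm]

theorem toMatrix_comp (σ τ : Substitution) :
    toMatrix (σ.comp τ) = σ.toMatrix * τ.toMatrix := by
  ext i j
  rw [Matrix.mul_apply]
  exact count_apply σ i (τ (of j))

theorem toMatrix_id : toMatrix (MonoidHom.id _) = 1 := by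
  ext i j
  simp [toMatrix, Matrix.one_apply, List.count_cons, eq_comm (a := i)]

theorem IsInvertible.comp {σ τ : Substitution} (hσ : σ.IsInvertible) (hτ : τ.IsInvertible) :
    IsInvertible (σ.comp τ) := by
  rw [IsInvertible, extend_comp]
  exact Function.Bijective.comp (g := σ.extend) hσ hτ

theorem isInvertible_ofPerm (π : Equiv.Perm (Fin 3)) : (ofPerm π).IsInvertible := by
  have h : ∀ π : Equiv.Perm (Fin 3), (extend (ofPerm π)).comp (extend (ofPerm π⁻¹)) =
      MonoidHom.id _ := fun π => by
    rw [← extend_comp, ← extend_id]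
    exact congrArg extend (FreeMonoid.hom_eq fun x => by simp [ofPerm])
  refine Function.bijective_iff_has_inverse.2 ⟨extend (ofPerm π⁻¹), fun x => ?_, fun x => ?_⟩
  · simpa using DFunLike.congr_fun (h π⁻¹) x
  · exact DFunLike.congr_fun (h π) x

theorem isInvertible_phiL : phiL.IsInvertible := by
  refine Function.bijective_iff_has_inverse.2
    ⟨FreeGroup.lift ![(FreeGroup.of 1)⁻¹ * FreeGroup.of 0, FreeGroup.of 1, FreeGroup.of 2], ?_, ?_⟩
  · refine DFunLike.congr_fun (f := (FreeGroup.lift _).comp (extend phiL))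
      (g := MonoidHom.id _) (FreeGroup.ext_hom _ _ fun x => ?_)
    fin_cases x <;> simp [extend, phiL, ofTriple]
  · refine DFunLike.congr_fun (f := (extend phiL).comp (FreeGroup.lift _))
      (g := MonoidHom.id _) (FreeGroup.ext_hom _ _ fun x => ?_)
    fin_cases x <;> simp [extend, phiL, ofTriple]

theorem isInvertible_phiR : phiR.IsInvertible := by
  refine Function.bijective_iff_has_inverse.2
    ⟨FreeGroup.lift ![FreeGroup.of 0 * (FreeGroup.of 1)⁻¹, FreeGroup.of 1, FreeGroup.of 2], ?_, ?_⟩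
  · refine DFunLike.congr_fun (f := (FreeGroup.lift _).comp (extend phiR))
      (g := MonoidHom.id _) (FreeGroup.ext_hom _ _ fun x => ?_)
    fin_cases x <;> simp [extend, phiR, ofTriple]
  · refine DFunLike.congr_fun (f := (extend phiR).comp (FreeGroup.lift _))
      (g := MonoidHom.id _) (FreeGroup.ext_hom _ _ fun x => ?_)
    fin_cases x <;> simp [extend, phiR, ofTriple]

theorem IsPermutation.isInvertible {σ : Substitution} (h : σ.IsPermutation) : σ.IsInvertible := by
  obtain ⟨π, rfl⟩ := h
  exact isInvertible_ofPerm π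

theorem IsFibonacci.isInvertible {σ : Substitution} (h : σ.IsFibonacci) : σ.IsInvertible := by
  obtain ⟨π, π', rfl | rfl⟩ := h
  · exact (isInvertible_ofPerm π).comp (isInvertible_phiL.comp (isInvertible_ofPerm π'))
  · exact (isInvertible_ofPerm π).comp (isInvertible_phiR.comp (isInvertible_ofPerm π'))

/-! ### Abelianization and consequences of surjectivity -/

/-- The exponent sums of an element of the free group. -/
def exponentSum : FreeGroup (Fin 3) →* Multiplicative (Fin 3 → ℤ) :=
  FreeGroup.lift fun i => Multiplicative.ofAdd (Pi.single i 1)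

theorem exponentSum_lift_of (w : FreeMonoid (Fin 3)) (i : Fin 3) :
    Multiplicative.toAdd (exponentSum (FreeMonoid.lift FreeGroup.of w)) i =
      (toList w).count i := by
  induction w using FreeMonoid.inductionOn' with
  | one => simp
  | of_mul x w ih =>
    rw [map_mul, map_mul, toAdd_mul, Pi.add_apply, ih]
    simp [exponentSum, Pi.single_apply, List.count_cons, add_comm, eq_comm (a := i)]

theorem exponentSum_extend (σ : Substitution) (g : FreeGroup (Fin 3)) :
    Multiplicative.toAdd (exponentSum (σ.extend g)) =
      (σ.toMatrix.map (Nat.cast : ℕ → ℤ)).mulVec (Multiplicative.toAdd (exponentSum g)) := by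
  have : exponentSum.comp σ.extend = (AddMonoidHom.toMultiplicative
      (Matrix.mulVecLin (σ.toMatrix.map (Nat.cast : ℕ → ℤ))).toAddMonoidHom).comp exponentSum := by
    refine FreeGroup.ext_hom _ _ fun j => Multiplicative.toAdd.injective (funext fun i => ?_)
    rw [MonoidHom.comp_apply, extend, FreeGroup.lift_apply_of, exponentSum_lift_of]
    simp [exponentSum, toMatrix]
  exact congrArg Multiplicative.toAdd (DFunLike.congr_fun this g)

/-- Exponent sums of preimages of the generators form a right inverse of the matrix. This excludes
zero columns (empty images) and zero rows (missing letters). -/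
theorem isUnit_det_of_surjective {σ : Substitution} (h : Function.Surjective σ.extend) :
    IsUnit (σ.toMatrix.map (Nat.cast : ℕ → ℤ)).det := by
  choose g hg using fun j => h (FreeGroup.of j)
  refine Matrix.isUnit_det_of_right_inverse
    (B := Matrix.of fun i j => Multiplicative.toAdd (exponentSum (g j)) i) ?_
  ext i j
  have := congrFun (exponentSum_extend σ (g j)) i
  rw [hg] at this
  rw [Matrix.mul_apply]
  refine Eq.trans this.symm ?_
  simp [exponentSum, Pi.single_apply, Matrix.one_apply]

theorem word_ne_nil {σ : Substitution} (h : Function.Surjective σ.extend) (j : Fin 3) :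
    σ.word j ≠ [] := by
  intro hj
  refine (isUnit_det_of_surjective h).ne_zero (Matrix.det_eq_zero_of_column_eq_zero j fun i => ?_)
  simp [toMatrix_apply, hj]

theorem exists_mem_word {σ : Substitution} (h : Function.Surjective σ.extend) (a : Fin 3) :
    ∃ j, a ∈ σ.word j := by
  by_contra! ha
  refine (isUnit_det_of_surjective h).ne_zero (Matrix.det_eq_zero_of_row_eq_zero a fun j => ?_)
  simp [toMatrix_apply, List.count_eq_zero.2 (ha j)]

theorem generates_word {σ : Substitution} (h : Function.Surjective σ.extend) :
    Generates σ.word := by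
  rw [Generates, ← MonoidHom.range_eq_top.2 h]
  simp only [← extend_of]
  rw [extend, FreeGroup.range_lift_eq_closure]
  simp

theorem surjective_of_conj {σ τ : Substitution} (h : Function.Surjective σ.extend)
    (g : FreeGroup (Fin 3))
    (hg : ∀ j, τ.extend (FreeGroup.of j) = g * σ.extend (FreeGroup.of j) * g⁻¹) :
    Function.Surjective τ.extend := by
  have : τ.extend = (MulAut.conj g).toMonoidHom.comp σ.extend :=
    FreeGroup.ext_hom _ _ fun j => by simp [hg]
  rw [this]
  exact (MulAut.conj g).surjective.comp h

/-! ### Splitting off a Fibonacci factor -/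

/-- The substitution `a ↦ ba` fixing the other letters. -/
def prepend (a b : Fin 3) : Substitution :=
  FreeMonoid.lift fun x => if x = a then of b * of a else of x

/-- The substitution `a ↦ ab` fixing the other letters. -/
def append (a b : Fin 3) : Substitution :=
  FreeMonoid.lift fun x => if x = a then of a * of b else of x

theorem exists_perm {a b : Fin 3} (h : a ≠ b) : ∃ π : Equiv.Perm (Fin 3), π 0 = a ∧ π 1 = b := by
  revert a b
  decide

theorem isFibonacci_prepend {a b : Fin 3} (h : a ≠ b) : (prepend a b).IsFibonacci := by
  obtain ⟨π, rfl, rfl⟩ := exists_perm h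
  refine ⟨π, π⁻¹, Or.inl (FreeMonoid.hom_eq fun x => ?_)⟩
  obtain ⟨y, rfl⟩ := π.surjective x
  fin_cases y <;> simp [prepend, ofPerm, phiL, ofTriple]

theorem isFibonacci_append {a b : Fin 3} (h : a ≠ b) : (append a b).IsFibonacci := by
  obtain ⟨π, rfl, rfl⟩ := exists_perm h
  refine ⟨π, π⁻¹, Or.inr (FreeMonoid.hom_eq fun x => ?_)⟩
  obtain ⟨y, rfl⟩ := π.surjective x
  fin_cases y <;> simp [append, ofPerm, phiR, ofTriple]

theorem length_prepend (a b : Fin 3) (w : FreeMonoid (Fin 3)) :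
    (toList (prepend a b w)).length = (toList w).length + (toList w).count a := by
  induction w using FreeMonoid.inductionOn' with
  | one => simp
  | of_mul x w ih =>
    rw [map_mul, toList_mul, List.length_append, ih]
    by_cases h : x = a <;> simp [prepend, h] <;> omega

theorem length_append (a b : Fin 3) (w : FreeMonoid (Fin 3)) :
    (toList (append a b w)).length = (toList w).length + (toList w).count a := by
  induction w using FreeMonoid.inductionOn' with
  | one => simp
  | of_mul x w ih =>
    rw [map_mul, toList_mul, List.length_append, ih]
    by_cases h : x = a <;> simp [append, h] <;> omega

/-- Each `a` is read together with the `b` before it, which the condition on the head guarantees to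
exist. -/
theorem exists_prepend_eq {a b : Fin 3} (hab : a ≠ b) {L : List (Fin 3)}
    (hL : L.IsChain fun s t => t = a → s = b) (ha : L.head? ≠ some a) :
    ∃ w, toList (prepend a b w) = L := by
  induction hn : L.length using Nat.strong_induction_on generalizing L with
  | _ n ih =>
    match L, hL, ha with
    | [], _, _ => exact ⟨1, by simp⟩
    | [s], _, ha =>
      have : s ≠ a := by simpa using ha
      exact ⟨of s, by simp [prepend, this]⟩
    | s :: t :: L, hL, ha =>
      have hs : s ≠ a := by simpa using ha
      obtain ⟨hst, hL⟩ := List.isChain_cons_cons.1 hL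
      by_cases ht : t = a
      · obtain rfl := hst ht
        subst ht
        -- After a block `ba` the rest cannot start with `a`, since that `a` would be preceded by `a
        -- ≠ b`.
        obtain ⟨w, hw⟩ := ih L.length (by simp at hn; omega) hL.tail (fun h => by
          cases L with
          | nil => simp at h
          | cons r L =>
            obtain rfl : r = t := by simpa using h
            exact hab ((List.isChain_cons_cons.1 hL).1 rfl)) rfl
        exact ⟨of t * w, by rw [map_mul, toList_mul, hw]; simp [prepend]⟩
      · obtain ⟨w, hw⟩ := ih _ (by simp at hn ⊢; omega) hL (by simpa using ht) rfl
        exact ⟨of s * w, by rw [map_mul, toList_mul, hw]; simp [prepend, hs]⟩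

theorem exists_append_eq {a b : Fin 3} (hab : a ≠ b) {L : List (Fin 3)}
    (hL : L.IsChain fun s t => s = a → t = b) (ha : L.getLast? ≠ some a) :
    ∃ w, toList (append a b w) = L := by
  induction hn : L.length using Nat.strong_induction_on generalizing L with
  | _ n ih =>
    match L, hL, ha with
    | [], _, _ => exact ⟨1, by simp⟩
    | [s], _, ha =>
      have : s ≠ a := by simpa using ha
      exact ⟨of s, by simp [append, this]⟩
    | s :: t :: L, hL, ha =>
      obtain ⟨hst, hL⟩ := List.isChain_cons_cons.1 hL
      rw [List.getLast?_cons_cons] at ha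
      by_cases hs : s = a
      · obtain rfl := hst hs
        subst hs
        obtain ⟨w, hw⟩ := ih L.length (by simp at hn; omega) hL.tail (fun h => by
          cases L with
          | nil => simp at h
          | cons r L => exact ha (by rwa [List.getLast?_cons_cons])) rfl
        exact ⟨of s * w, by rw [map_mul, toList_mul, hw]; simp [append]⟩
      · obtain ⟨w, hw⟩ := ih _ (by simp at hn ⊢; omega) hL ha rfl
        exact ⟨of s * w, by rw [map_mul, toList_mul, hw]; simp [append, hs]⟩

/-- The total length of the images of the letters. -/
def size (σ : Substitution) : ℕ := ∑ j, (σ.word j).length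

/-- Every substitution whose words are images of words under an invertible substitution that makes
words longer by the number of occurrences of `a` has a factorization with a smaller right factor. -/
theorem exists_factor {σ τ : Substitution} {a : Fin 3} (hσ : Function.Surjective σ.extend)
    (hτ : τ.IsInvertible)
    (hlen : ∀ w, (toList (τ w)).length = (toList w).length + (toList w).count a)
    (h : ∀ j, ∃ w, toList (τ w) = σ.word j) :
    ∃ σ' : Substitution, Function.Surjective σ'.extend ∧
      σ.toMatrix = τ.toMatrix * σ'.toMatrix ∧ σ'.size < σ.size := by
  choose w hw using h
  have hcomp : σ = τ.comp (FreeMonoid.lift w) := FreeMonoid.hom_eq fun j => by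
    simpa using toList.injective (hw j).symm
  have hsurj : Function.Surjective (extend (FreeMonoid.lift w)) := by
    rw [hcomp, extend_comp] at hσ
    exact Function.Surjective.of_comp_left hσ hτ.1
  refine ⟨FreeMonoid.lift w, hsurj, by rw [← toMatrix_comp, ← hcomp], ?_⟩
  have hword : ∀ j, (σ.word j).length =
      (word (FreeMonoid.lift w) j).length + (word (FreeMonoid.lift w) j).count a := fun j => by
    rw [← hw, hlen]
    simp [word]
  obtain ⟨j, hj⟩ := exists_mem_word hsurj a
  refine Finset.sum_lt_sum (fun j _ => by rw [hword]; omega) ⟨j, Finset.mem_univ _, ?_⟩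
  have := List.count_pos_iff.2 hj
  rw [hword]
  omega

theorem exists_fibonacci_factor {σ : Substitution} (hσ : Function.Surjective σ.extend)
    (hsize : 4 ≤ σ.size) :
    ∃ τ σ' : Substitution, τ.IsFibonacci ∧ Function.Surjective σ'.extend ∧
      σ.toMatrix = τ.toMatrix * σ'.toMatrix ∧ σ'.size < σ.size := by
  -- It suffices to factor a rotation of `σ`.
  have key : ∀ (σ₁ τ : Substitution) (a : Fin 3), (∃ g, ∀ j, σ₁.extend (FreeGroup.of j) =
      g * σ.extend (FreeGroup.of j) * g⁻¹) → (∀ j, (σ₁.word j).Perm (σ.word j)) →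
      τ.IsFibonacci →
      (∀ w, (toList (τ w)).length = (toList w).length + (toList w).count a) →
      (∀ j, ∃ w, toList (τ w) = σ₁.word j) →
      ∃ τ σ' : Substitution, τ.IsFibonacci ∧ Function.Surjective σ'.extend ∧
        σ.toMatrix = τ.toMatrix * σ'.toMatrix ∧ σ'.size < σ.size := by
    rintro σ₁ τ a ⟨g, hg⟩ hperm hτ hlen hw
    obtain ⟨σ', hs, hM, hlt⟩ := exists_factor (surjective_of_conj hσ g hg) hτ.isInvertible hlen hw
    refine ⟨τ, σ', hτ, hs, ?_, ?_⟩
    · rw [← hM]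
      ext i j
      rw [toMatrix_apply, toMatrix_apply, (hperm j).count_eq]
    · simpa only [size, (hperm _).length_eq] using hlt
  obtain ⟨a, b, hab, hch | hch⟩ := (generates_word hσ).exists_forced (word_ne_nil hσ)
    (exists_mem_word hσ) hsize
  · by_cases hhead : ∃ j, (σ.word j).head? = some a
    · obtain ⟨j, hj⟩ := hhead
      obtain ⟨L, hL⟩ : ∃ L, σ.word j = a :: L := by
        simpa [List.head?_eq_some_iff] using hj
      -- Some image begins with `a`; since it may follow any image, every image ends with `b`, and
      -- this `b` can be moved to the front of all of them.
      have hend : ∀ i, ∃ t, σ.word i = t ++ [b] := by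
        intro i
        obtain ⟨t, s, hs⟩ := (List.eq_nil_or_concat' (σ.word i)).resolve_left (word_ne_nil hσ i)
        have := hch i j
        rw [hL, hs, List.append_assoc, List.singleton_append] at this
        exact ⟨t, (List.isChain_cons_cons.1 this.right_of_append).1 rfl ▸ hs⟩
      choose t ht using hend
      have hword := word_ofWords fun i => b :: t i
      refine key (ofWords fun i => b :: t i) (prepend a b) a ⟨FreeGroup.of b, fun i => ?_⟩
        (fun i => ?_) (isFibonacci_prepend hab) (length_prepend a b) fun i => ?_
      · rw [extend_of, extend_of, hword, ht, eq_mul_inv_iff_mul_eq, FreeGroup.of,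
          FreeGroup.mul_mk, FreeGroup.mul_mk]
        simp [positive]
      · rw [hword, ht]
        exact (List.perm_append_singleton b (t i)).symm
      · rw [hword]
        refine exists_prepend_eq hab ?_ (by simpa using hab.symm)
        -- The rotated word is a factor of the square of the original one.
        have := hch i i
        rw [ht, List.append_assoc, List.singleton_append, ← List.cons_append] at this
        exact this.right_of_append.left_of_append
    · push Not at hhead
      exact key σ (prepend a b) a ⟨1, by simp⟩ (fun _ => List.Perm.refl _)
        (isFibonacci_prepend hab) (length_prepend a b)
        fun i => exists_prepend_eq hab (hch i i).left_of_append (hhead i)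
  · by_cases hlast : ∃ j, (σ.word j).getLast? = some a
    · obtain ⟨j, hj⟩ := hlast
      obtain ⟨L, hL⟩ : ∃ L, σ.word j = L ++ [a] := List.getLast?_eq_some_iff.1 hj
      -- Mirror case: an image ending with `a` forces every image to start with `b`.
      have hstart : ∀ i, ∃ t, σ.word i = b :: t := by
        intro i
        obtain ⟨s, t, hs⟩ := List.exists_cons_of_ne_nil (word_ne_nil hσ i)
        have := hch j i
        rw [hL, hs, List.append_assoc, List.singleton_append] at this
        exact ⟨t, (List.isChain_cons_cons.1 this.right_of_append).1 rfl ▸ hs⟩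
      choose t ht using hstart
      have hword := word_ofWords fun i => t i ++ [b]
      refine key (ofWords fun i => t i ++ [b]) (append a b) a ⟨(FreeGroup.of b)⁻¹, fun i => ?_⟩
        (fun i => ?_) (isFibonacci_append hab) (length_append a b) fun i => ?_
      · rw [extend_of, extend_of, hword, ht, inv_inv, mul_assoc, eq_inv_mul_iff_mul_eq,
          FreeGroup.of, FreeGroup.mul_mk, FreeGroup.mul_mk]
        simp [positive]
      · rw [hword, ht]
        exact List.perm_append_singleton b (t i)
      · rw [hword]
        refine exists_append_eq hab ?_ (by simpa using hab.symm)
        have := (hch i i).tail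
        rw [ht, List.cons_append, List.tail_cons, ← List.singleton_append (x := b),
          ← List.append_assoc] at this
        exact this.left_of_append
    · push Not at hlast
      exact key σ (append a b) a ⟨1, by simp⟩ (fun _ => List.Perm.refl _)
        (isFibonacci_append hab) (length_append a b)
        fun i => exists_append_eq hab (hch i i).left_of_append (hlast i)

/-- Three nonempty images of total length at most three are single letters, and all letters occur
among them. -/
theorem isPermutation_of_size_le {σ : Substitution} (hσ : Function.Surjective σ.extend)
    (hsize : σ.size ≤ 3) : σ.IsPermutation := by
  have hpos : ∀ j, 0 < (σ.word j).length := fun j => List.length_pos_iff.2 (word_ne_nil hσ j)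
  have hone : ∀ j, (σ.word j).length = 1 := by
    have h₀ := hpos 0
    have h₁ := hpos 1
    have h₂ := hpos 2
    rw [size, Fin.sum_univ_three] at hsize
    intro j
    fin_cases j <;> simp only [Fin.zero_eta, Fin.mk_one, Fin.reduceFinMk] <;> omega
  choose f hf using fun j => List.length_eq_one_iff.1 (hone j)
  have hsurj : Function.Surjective f := fun a => by
    obtain ⟨j, hj⟩ := exists_mem_word hσ a
    exact ⟨j, by simpa [hf, eq_comm] using hj⟩
  refine ⟨Equiv.ofBijective f (Finite.surjective_iff_bijective.1 hsurj), FreeMonoid.hom_eq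
    fun j => toList.injective ?_⟩
  simpa [ofPerm, word] using hf j

theorem exists_list_prod_eq {σ : Substitution} (hσ : Function.Surjective σ.extend) :
    ∃ L : List (Matrix (Fin 3) (Fin 3) ℕ),
      (∀ E ∈ L, IsNonnegElementary E) ∧ L.prod = σ.toMatrix := by
  induction hn : σ.size using Nat.strong_induction_on generalizing σ with
  | _ n ih =>
    by_cases h : σ.size ≤ 3
    · refine ⟨[σ.toMatrix], ?_, by simp⟩
      simpa using ⟨σ, Or.inl (isPermutation_of_size_le hσ h), rfl⟩
    · obtain ⟨τ, σ', hτ, hσ', hM, hlt⟩ := exists_fibonacci_factor hσ (by omega)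
      obtain ⟨L, hL, hprod⟩ := ih _ (hn ▸ hlt) hσ' rfl
      refine ⟨τ.toMatrix :: L, ?_, by rw [List.prod_cons, hprod, hM]⟩
      simpa using ⟨⟨τ, Or.inr hτ, rfl⟩, hL⟩

theorem exists_isInvertible_of_list (L : List (Matrix (Fin 3) (Fin 3) ℕ))
    (hL : ∀ E ∈ L, IsNonnegElementary E) :
    ∃ σ : Substitution, σ.IsInvertible ∧ σ.toMatrix = L.prod := by
  induction L with
  | nil =>
    refine ⟨MonoidHom.id _, ?_, toMatrix_id⟩
    rw [IsInvertible, extend_id]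
    exact Function.bijective_id
  | cons E L ih =>
    obtain ⟨τ, hτ, rfl⟩ := hL E (by simp)
    obtain ⟨σ, hσ, hM⟩ := ih fun E hE => hL E (by simp [hE])
    refine ⟨τ.comp σ, ?_, by rw [toMatrix_comp, hM, List.prod_cons]⟩
    exact (hτ.elim IsPermutation.isInvertible IsFibonacci.isInvertible).comp hσ

end Substitution

theorem theorem2p2 (M : Matrix (Fin 3) (Fin 3) ℕ) :
    (∃ σ : Substitution, σ.IsInvertible ∧ σ.toMatrix = M) ↔
      ∃ L : List (Matrix (Fin 3) (Fin 3) ℕ), (∀ E ∈ L, IsNonnegElementary E) ∧ L.prod = M := by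
  constructor
  · rintro ⟨σ, hσ, rfl⟩
    exact Substitution.exists_list_prod_eq hσ.2
  · rintro ⟨L, hL, rfl⟩
    exact Substitution.exists_isInvertible_of_list L hL
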